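/- Let $\Omega_h$ be a finite nonempty set of $N$ grid points with grid size $h>0$ in dimension $d$, and let $\mathcal L_h\in\mathbb R^{N\times N}$ be a discretized Dirichlet Laplacian such that $-\mathcal L_h$ is symmetric positive definite, has nonpositive off-diagonal entries (M-matrix case), and the grid is connected: any two grid points are joined by a chain of grid points in which consecutive points $i\ne j$ satisfy $\mathcal L_h(i,j)\neq 0$. Let $V_h(i)\ge 0$ for all $i$ and $\beta\ge 0$. For $u,w\in\mathbb R^N$ put $(u,w)_{L_h^2}=\sum_i u(i)w(i)h^d$, $\|u\|_{L^2_h}=(u,u)_{L^2_h}^{1/2}$, and $$E_h(u)=u^\top(-\mathcal L_h)u\,h^d+\sum_i V_h(i)u(i)^2h^d+\frac{\beta}{2}\sum_i u(i)^4h^d .$$ A ground state is a minimizer of $E_h$ on $\{\|u\|_{L_h^2}=1\}$. Let $\mathcal A_{u}=-\mathcal L_h+\operatorname{diag}(V_h(i)+\beta u(i)^2)$, $(z,w)_{a_u}=(\mathcal A_u z,w)_{L_h^2}$, $\|z\|_{a_u}=(z,z)_{a_u}^{1/2}$, and let $\mathcal G_u=\mathcal A_u^{-1}$, so that $(z,\mathcal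 G_uw)_{a_u}=(z,w)_{L_h^2}$ for all $z,w$. Sobolev projected gradient descent (Sobolev PGD) for $E_h$ with step sizes $\tau_n$ is $$u_{n+1}=R\Big(u_n-\tau_n\Big(u_n-\frac{(u_n,u_n)_{L_h^2}}{(\mathcal G_{u_n}u_n,\mathcal G_{u_n}u_n)_{a_{u_n}}}\mathcal G_{u_n}u_n\Big)\Big),\qquad R(u)=u/\|u\|_{L_h^2}.$$ Then there is a ground state $v_h$ with $v_h(i)>0$ for all $i$, and it is the unique ground state up to sign. Moreover there is $\tau_{\max}\in(0,1]$, depending only on the problem data $(h,d,\mathcal L_h,V_h,\beta)$, such that for every $\tau_{\min}\in(0,\tau_{\max}]$ there is a rate $q\in(0,1)$, depending only on the problem data, $\tau_{\min}$ and $\tau_{\max}$, with the following property. For every initial state $u_0$ with $\|u_0\|_{L_h^2}=1$ and $u_0(i)\ge 0$ for all $i$, and all step sizes with $\tau_{\min}\le\tau_n\le\tau_{\max}$ for all $n$, the Sobolev PGD sequence converges to $v_h$, asymptotically exponentially: there are $C$ and $n_0$ with $\|u_n-v_h\|_{a_0}\le Cq^n$ for all $n\ge n_0$. -/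

import Mathlib

open Filter Topology Matrix

noncomputable section

namespace DiscreteGP

/-- The data of the spatially discretized Gross-Pitaevskii problem, with grid points indexed by `ι`:
space dimension `d`, grid size `h`, discretized Laplacian `L`, potential `V`, and interaction
parameter `β`.  (No condition is imposed here.) -/
structure GPData (ι : Type*) where
  d : ℕ
  h : ℝ
  L : Matrix ι ι ℝ
  V : ι → ℝ
  β : ℝ

/-- `L` is a discretized Laplacian (with zero Dirichlet boundary values) for which `-L` is an
M-matrix, on a connected grid.  `-L` is symmetric positive definite, its off-diagonal entries are
nonpositive, and any two grid points are joined by a chain of neighbouring grid points, where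
distinct `i`, `j` are neighbours when `L i j` is nonzero.  (Connectedness includes that there is at
least one grid point.) -/
structure IsDiscreteLaplacian {ι : Type*} (L : Matrix ι ι ℝ) : Prop where
  posDef : (-L).PosDef
  offDiag : ∀ i j, i ≠ j → (-L) i j ≤ 0
  connected : (SimpleGraph.fromRel fun i j => L i j ≠ 0).Connected

namespace GPData

variable {ι : Type*} [Fintype ι] (D : GPData ι)

/-- The discrete `L²` inner product. -/
def l2Inner (z w : ι → ℝ) : ℝ := ∑ i, z i * w i * D.h ^ D.d

/-- The discrete `L²` norm. -/
def l2Norm (z : ι → ℝ) : ℝ := √(D.l2Inner z z)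

/-- The discrete energy `E_h`. -/
def energy (u : ι → ℝ) : ℝ :=
  (u ⬝ᵥ ((-D.L) *ᵥ u)) * D.h ^ D.d + ∑ i, D.V i * u i ^ 2 * D.h ^ D.d
    + D.β / 2 * ∑ i, u i ^ 4 * D.h ^ D.d

/-- A ground state: a global minimizer of the energy on the discrete `L²` unit sphere. -/
def IsGroundState (v : ι → ℝ) : Prop :=
  D.l2Norm v = 1 ∧ ∀ w : ι → ℝ, D.l2Norm w = 1 → D.energy v ≤ D.energy w

/-- The retraction onto the discrete `L²` unit sphere. -/
def retraction (u : ι → ℝ) : ι → ℝ := (D.l2Norm u)⁻¹ • u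

variable [DecidableEq ι]

/-- The linearized operator `A_u = -L + diag (V + β u²)`. -/
def linOp (u : ι → ℝ) : Matrix ι ι ℝ :=
  -D.L + Matrix.diagonal fun i => D.V i + D.β * u i ^ 2

/-- The adaptive inner product `(z, w)_{a_u} = (A_u z, w)_{L²}`. -/
def aInner (u z w : ι → ℝ) : ℝ := D.l2Inner (D.linOp u *ᵥ z) w

/-- The norm of the inner product `(·, ·)_{a_u}`. -/
def aNorm (u z : ι → ℝ) : ℝ := √(D.aInner u z z)

/-- The Green's operator `G_u` of the inner product `(·, ·)_{a_u}`; see `aInner_green`. -/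
def green (u w : ι → ℝ) : ι → ℝ := (D.linOp u)⁻¹ *ᵥ w

/-- Under the standing assumptions the linearized operator is positive definite. -/
theorem linOp_posDef (hL : IsDiscreteLaplacian D.L) (hV : ∀ i, 0 ≤ D.V i) (hβ : 0 ≤ D.β)
    (u : ι → ℝ) : (D.linOp u).PosDef :=
  hL.posDef.add_posSemidef <| Matrix.PosSemidef.diagonal fun i => by
    have := hV i
    positivity

/-- The defining property of the Green's operator: `(z, G_u w)_{a_u} = (z, w)_{L²}`. -/
theorem aInner_green (hL : IsDiscreteLaplacian D.L) (hV : ∀ i, 0 ≤ D.V i) (hβ : 0 ≤ D.β)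
    (u z w : ι → ℝ) : D.aInner u z (D.green u w) = D.l2Inner z w := by
  have hp := D.linOp_posDef hL hV hβ u
  have hT : (D.linOp u)ᵀ = D.linOp u := by simpa using hp.isHermitian.eq
  have hu : IsUnit (D.linOp u).det := hp.det_pos.ne'.isUnit
  have key : (D.linOp u *ᵥ z) ⬝ᵥ ((D.linOp u)⁻¹ *ᵥ w) = z ⬝ᵥ w := by
    rw [← Matrix.vecMul_transpose, hT, ← Matrix.dotProduct_mulVec, Matrix.mulVec_mulVec,
      Matrix.mul_nonsing_inv _ hu, Matrix.one_mulVec]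
  simp only [aInner, green, l2Inner, ← Finset.sum_mul]
  exact congrArg (· * D.h ^ D.d) key

/-- The manifold gradient of the energy for the inner product `(·, ·)_{a_u}`, for which the Sobolev
gradient of the energy at `u` is `u`: the projection of `u` onto the tangent space at `u`. -/
def grad (u : ι → ℝ) : ι → ℝ :=
  u - (D.l2Inner u u / D.aInner u (D.green u u) (D.green u u)) • D.green u u

/-- The Sobolev projected gradient descent for the energy, with step sizes `τ` and initial state
`u₀`. -/
def sobolevPGD (τ : ℕ → ℝ) (u₀ : ι → ℝ) : ℕ → ι → ℝ
  | 0 => u₀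
  | n + 1 => D.retraction (sobolevPGD τ u₀ n - τ n • D.grad (sobolevPGD τ u₀ n))

end GPData

end DiscreteGP

end

/-! The energy is quadratic in the density `u²`, so `energy_sub_energy` is exact: `E(w) - E(u)`
equals `(w,w)_{a_u} - (u,u)_{a_u}` plus a nonnegative remainder.

Static part. A normalized nonnegative critical point `v` satisfies `A_v v = l v`. The M-matrix sign
pattern and connectedness force `v > 0`, and the ground state representation writes `(x,x)_{a_v} - l
(x,x)` (the gap form) as a weighted sum of squares of `x_i/v_i - x_j/v_j`. Hence the gap form is
nonnegative and vanishes only on multiples of `v`. On the sphere it is bounded by `E(x) - E(v)`, so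
`v` is a global minimizer, unique up to sign. Such a `v` exists: take the absolute value of any
minimizer.

Dynamic part. A step moves along the tangent space, so the retraction only shrinks, and small steps
decrease the energy by at least `t` times the squared gradient norm, uniformly on the sphere
(`exists_energy_decrease`). Steps `t ≤ 1` preserve nonnegativity because `G_u` does. The gradients
therefore tend to zero, and compactness with uniqueness of `v` gives convergence. Near `v`, a
Polyak–Łojasiewicz inequality makes the energy excess contract geometrically, and quadratic growth
turns this into a rate for the distance (`eventually_energy_bounds`). -/

noncomputable section

namespace DiscreteGP

/-! ### M-matrices and quadratic forms. -/

section MMatrix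

variable {ι : Type*} [Fintype ι]

/-- A positive definite matrix with nonpositive off-diagonal entries is monotone. -/
theorem nonneg_of_mulVec_nonneg {A : Matrix ι ι ℝ} (hA : A.PosDef)
    (hoff : ∀ i j, i ≠ j → A i j ≤ 0) {x : ι → ℝ} (hx : ∀ i, 0 ≤ (A *ᵥ x) i) (i : ι) :
    0 ≤ x i := by
  set m : ι → ℝ := fun i => max (-x i) 0 with hm
  set p : ι → ℝ := fun i => max (x i) 0 with hp
  have hxpm : x = p - m := by
    ext j
    simp only [hm, hp, Pi.sub_apply]
    rcases le_total (x j) 0 with h | h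
    · rw [max_eq_right h, max_eq_left (by linarith)]; ring
    · rw [max_eq_left h, max_eq_right (by linarith)]; ring
  have h1 : 0 ≤ m ⬝ᵥ (A *ᵥ x) :=
    Finset.sum_nonneg fun j _ => mul_nonneg (le_max_right _ _) (hx j)
  -- The two parts have disjoint supports, so only off-diagonal entries contribute. With `h1` this
  -- gives `m ⬝ᵥ A m ≤ 0`, forcing `m = 0`.
  have h2 : m ⬝ᵥ (A *ᵥ p) ≤ 0 := by
    refine Finset.sum_nonpos fun j _ => ?_
    simp only [mulVec, dotProduct, Finset.mul_sum]
    refine Finset.sum_nonpos fun k _ => ?_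
    have hmj : 0 ≤ m j := le_max_right _ _
    have hpk : 0 ≤ p k := le_max_right _ _
    by_cases hjk : j = k
    · subst hjk
      have : m j * p j = 0 := by
        simp only [hm, hp]
        rcases le_total (x j) 0 with h | h
        · rw [max_eq_right h, mul_zero]
        · rw [max_eq_right (by linarith : -x j ≤ 0), zero_mul]
      exact le_of_eq (by linear_combination A j j * this)
    · have := hoff j k hjk
      exact mul_nonpos_of_nonneg_of_nonpos hmj (mul_nonpos_of_nonpos_of_nonneg this hpk)
  have h3 : m = 0 := by
    by_contra hne
    have := hA.dotProduct_mulVec_pos hne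
    simp only [star_trivial] at this
    rw [hxpm, mulVec_sub, dotProduct_sub] at h1
    linarith
  have := congrFun h3 i
  simp only [hm, Pi.zero_apply, max_eq_right_iff] at this
  linarith

omit [Fintype ι] in
/-- A statement about indices that passes to neighbours holds everywhere on a connected grid. -/
theorem IsDiscreteLaplacian.forall_of_step {L : Matrix ι ι ℝ} (hL : IsDiscreteLaplacian L)
    {P : ι → Prop} (hstep : ∀ i j, i ≠ j → L i j ≠ 0 → P i → P j) {i : ι} (hi : P i) (j : ι) :
    P j := by
  have hsymm : ∀ i j, L i j = L j i := fun i j => by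
    have := congrFun (congrFun hL.posDef.isHermitian.eq j) i
    simpa using this
  obtain ⟨w⟩ := hL.connected.preconnected i j
  induction w with
  | nil => exact hi
  | cons h _ ih =>
    refine ih (hstep _ _ h.ne ?_ hi)
    rw [SimpleGraph.fromRel_adj] at h
    rcases h.2 with h | h
    · exact h
    · rwa [hsymm]

/-- The ground state representation of a quadratic form with positive eigenvector `v`. -/
theorem two_mul_quadratic_form_sub {A : Matrix ι ι ℝ} (hA : Aᵀ = A) {v : ι → ℝ}
    (hv : ∀ i, 0 < v i) {l : ℝ} (hAv : A *ᵥ v = l • v) (x : ι → ℝ) :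
    2 * ((A *ᵥ x) ⬝ᵥ x - l * (x ⬝ᵥ x)) =
      ∑ i, ∑ j, -A i j * (v i * v j * (x i / v i - x j / v j) ^ 2) := by
  have hs : ∀ i j, A i j = A j i := fun i j => congrFun (congrFun hA j) i
  have h1 : ∑ i, ∑ j, A i j * v j * (x i ^ 2 / v i) = l * (x ⬝ᵥ x) := by
    rw [dotProduct, Finset.mul_sum]
    refine Finset.sum_congr rfl fun i _ => ?_
    rw [← Finset.sum_mul]
    have : ∑ j, A i j * v j = l * v i := by simpa [mulVec, dotProduct] using congrFun hAv i
    rw [this]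
    have := (hv i).ne'
    field_simp
  have h2 : ∑ i, ∑ j, A i j * v i * (x j ^ 2 / v j) = l * (x ⬝ᵥ x) := by
    rw [Finset.sum_comm, ← h1]
    refine Finset.sum_congr rfl fun i _ => Finset.sum_congr rfl fun j _ => ?_
    rw [hs]
  have h3 : (A *ᵥ x) ⬝ᵥ x = ∑ i, ∑ j, A i j * x i * x j := by
    simp only [mulVec, dotProduct, Finset.sum_mul]
    refine Finset.sum_congr rfl fun i _ => Finset.sum_congr rfl fun j _ => ?_
    ring
  -- Expand the square; the two pure terms are summed by the eigenvalue equation in `h1` and `h2`.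
  have h4 : ∀ i j, -A i j * (v i * v j * (x i / v i - x j / v j) ^ 2) =
      2 * (A i j * x i * x j) - A i j * v j * (x i ^ 2 / v i)
        - A i j * v i * (x j ^ 2 / v j) := fun i j => by
    have := (hv i).ne'
    have := (hv j).ne'
    field_simp
    ring
  simp only [h4, Finset.sum_sub_distrib, ← Finset.mul_sum, h1, h2, h3]
  ring

/-- A 2-homogeneous continuous function is dominated by a positive one. -/
theorem exists_le_mul_of_homogeneous {f g : (ι → ℝ) → ℝ} (hf : Continuous f) (hg : Continuous g)
    (hf2 : ∀ (t : ℝ) x, f (t • x) = t ^ 2 * f x) (hg2 : ∀ (t : ℝ) x, g (t • x) = t ^ 2 * g x)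
    (hpos : ∀ x, x ≠ 0 → 0 < f x) : ∃ K : ℝ, 0 < K ∧ ∀ x, g x ≤ K * f x := by
  have hne : ∀ x ∈ Metric.sphere (0 : ι → ℝ) 1, f x ≠ 0 := fun x hx =>
    (hpos x fun h => by simp [h] at hx).ne'
  obtain ⟨K, hK⟩ := ((isCompact_sphere (0 : ι → ℝ) 1).image_of_continuousOn
    (hg.continuousOn.div hf.continuousOn hne)).bddAbove
  refine ⟨max K 1, by positivity, fun x => ?_⟩
  rcases eq_or_ne x 0 with rfl | hx
  · have h1 := hf2 0 0
    have h2 := hg2 0 0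
    simp only [zero_smul] at h1 h2
    rw [h1, h2]
    simp
  have hn : 0 < ‖x‖ := norm_pos_iff.2 hx
  have hmem : ‖x‖⁻¹ • x ∈ Metric.sphere (0 : ι → ℝ) 1 := by
    simp [norm_smul, hn.ne']
  have h := hK ⟨_, hmem, rfl⟩
  have hfx := hpos x hx
  simp only [Pi.div_apply, hf2, hg2] at h
  rw [mul_div_mul_left _ _ (by positivity), div_le_iff₀ hfx] at h
  exact h.trans (mul_le_mul_of_nonneg_right (le_max_left _ _) hfx.le)

end MMatrix

/-! ### Discrete `L²` geometry and existence of a minimizer. -/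

namespace GPData

variable {ι : Type*} [Fintype ι] {D : GPData ι}

/-- The standing assumptions on the data. -/
structure Admissible (D : GPData ι) : Prop where
  h_pos : 0 < D.h
  lap : IsDiscreteLaplacian D.L
  V_nonneg : ∀ i, 0 ≤ D.V i
  β_nonneg : 0 ≤ D.β

omit [Fintype ι] in
theorem Admissible.cell_pos (hD : D.Admissible) : 0 < D.h ^ D.d := pow_pos hD.h_pos _

theorem l2Inner_eq (z w : ι → ℝ) : D.l2Inner z w = (z ⬝ᵥ w) * D.h ^ D.d := by
  simp only [l2Inner, dotProduct, Finset.sum_mul]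

theorem l2Inner_comm (z w : ι → ℝ) : D.l2Inner z w = D.l2Inner w z := by
  rw [l2Inner_eq, l2Inner_eq, dotProduct_comm]

theorem l2Inner_smul_left (t : ℝ) (z w : ι → ℝ) :
    D.l2Inner (t • z) w = t * D.l2Inner z w := by
  simp only [l2Inner_eq, smul_dotProduct, smul_eq_mul]; ring

theorem l2Inner_sub_left (x z w : ι → ℝ) :
    D.l2Inner (x - z) w = D.l2Inner x w - D.l2Inner z w := by
  simp only [l2Inner_eq, sub_dotProduct]; ring

theorem l2Inner_add_smul_self (t : ℝ) (x y : ι → ℝ) :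
    D.l2Inner (x + t • y) (x + t • y) =
      D.l2Inner x x + 2 * t * D.l2Inner x y + t ^ 2 * D.l2Inner y y := by
  simp only [l2Inner_eq, add_dotProduct, dotProduct_add, smul_dotProduct, dotProduct_smul,
    smul_eq_mul, dotProduct_comm y x]
  ring

theorem l2Inner_smul_self (t : ℝ) (x : ι → ℝ) :
    D.l2Inner (t • x) (t • x) = t ^ 2 * D.l2Inner x x := by
  rw [l2Inner_smul_left, l2Inner_comm, l2Inner_smul_left]; ring

@[fun_prop]
theorem continuous_l2Inner {X : Type*} [TopologicalSpace X] {f g : X → ι → ℝ}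
    (hf : Continuous f) (hg : Continuous g) : Continuous fun x => D.l2Inner (f x) (g x) := by
  unfold l2Inner
  fun_prop

theorem Admissible.l2Inner_self_nonneg (hD : D.Admissible) (x : ι → ℝ) : 0 ≤ D.l2Inner x x :=
  Finset.sum_nonneg fun _ _ => mul_nonneg (mul_self_nonneg _) hD.cell_pos.le

theorem Admissible.l2Inner_self_pos (hD : D.Admissible) {x : ι → ℝ} (hx : x ≠ 0) :
    0 < D.l2Inner x x := by
  rw [l2Inner_eq]
  refine mul_pos ?_ hD.cell_pos
  simpa using dotProduct_star_self_pos_iff.2 hx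

theorem Admissible.sq_mul_le_l2Inner (hD : D.Admissible) (x : ι → ℝ) (i : ι) :
    x i ^ 2 * D.h ^ D.d ≤ D.l2Inner x x := by
  rw [sq]
  exact Finset.single_le_sum (f := fun i => x i * x i * D.h ^ D.d)
    (fun j _ => mul_nonneg (mul_self_nonneg _) hD.cell_pos.le) (Finset.mem_univ i)

theorem l2Norm_eq_one_iff {x : ι → ℝ} :
    D.l2Norm x = 1 ↔ D.l2Inner x x = 1 := by
  rw [l2Norm, Real.sqrt_eq_one]

theorem ne_zero_of_l2Inner {u : ι → ℝ} (hu : D.l2Inner u u = 1) : u ≠ 0 := by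
  rintro rfl
  simp [l2Inner] at hu

theorem Admissible.l2Inner_retraction (hD : D.Admissible) {x : ι → ℝ} (hx : x ≠ 0) :
    D.l2Inner (D.retraction x) (D.retraction x) = 1 := by
  have := hD.l2Inner_self_pos hx
  rw [retraction, l2Inner_smul_self, inv_pow, l2Norm, Real.sq_sqrt this.le,
    inv_mul_cancel₀ this.ne']

theorem Admissible.isCompact_unitSphere (hD : D.Admissible) :
    IsCompact {u : ι → ℝ | D.l2Inner u u = 1} := by
  refine Metric.isCompact_of_isClosed_isBounded
    (isClosed_eq (by fun_prop) continuous_const) ?_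
  refine (Metric.isBounded_closedBall (x := (0 : ι → ℝ)) (r := √(D.h ^ D.d)⁻¹)).subset ?_
  intro u hu
  rw [mem_closedBall_zero_iff, pi_norm_le_iff_of_nonneg (by positivity)]
  intro i
  rw [Real.norm_eq_abs]
  refine Real.abs_le_sqrt ?_
  have := hD.sq_mul_le_l2Inner u i
  rw [show D.l2Inner u u = 1 from hu] at this
  rwa [← one_div, le_div_iff₀ hD.cell_pos]

/-- Every term is nonnegative and homogeneous of degree 2 or 4. This is what makes the retraction
harmless for the energy. -/
theorem energy_smul_le (hD : D.Admissible) {t : ℝ} (h0 : 0 ≤ t) (h1 : t ≤ 1) (u : ι → ℝ) :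
    D.energy (t • u) ≤ D.energy u := by
  have hc := hD.cell_pos
  have hβ := hD.β_nonneg
  have hq : 0 ≤ u ⬝ᵥ ((-D.L) *ᵥ u) := by
    simpa using hD.lap.posDef.posSemidef.dotProduct_mulVec_nonneg u
  have hV : 0 ≤ ∑ i, D.V i * u i ^ 2 * D.h ^ D.d :=
    Finset.sum_nonneg fun i _ => by have := hD.V_nonneg i; positivity
  have h4 : 0 ≤ ∑ i, u i ^ 4 * D.h ^ D.d := Finset.sum_nonneg fun i _ => by positivity
  have e : D.energy (t • u) = t ^ 2 * ((u ⬝ᵥ ((-D.L) *ᵥ u)) * D.h ^ D.d)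
      + t ^ 2 * ∑ i, D.V i * u i ^ 2 * D.h ^ D.d
      + t ^ 4 * (D.β / 2 * ∑ i, u i ^ 4 * D.h ^ D.d) := by
    simp only [energy, mulVec_smul, dotProduct_smul, smul_dotProduct, Pi.smul_apply, smul_eq_mul,
      Finset.mul_sum]
    congr 1
    · congr 1
      · ring
      · exact Finset.sum_congr rfl fun i _ => by ring
    · exact Finset.sum_congr rfl fun i _ => by ring
  have t2 : t ^ 2 ≤ 1 := pow_le_one₀ h0 h1
  have t4 : t ^ 4 ≤ 1 := pow_le_one₀ h0 h1
  rw [e, energy]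
  have a1 := mul_le_of_le_one_left (mul_nonneg hq hc.le) t2
  have a2 := mul_le_of_le_one_left hV t2
  have a3 := mul_le_of_le_one_left (mul_nonneg (by positivity : 0 ≤ D.β / 2) h4) t4
  linarith

theorem continuous_energy : Continuous D.energy := by
  unfold energy
  have h : Continuous fun u : ι → ℝ => u ⬝ᵥ ((-D.L) *ᵥ u) :=
    continuous_id.dotProduct (continuous_const.matrix_mulVec continuous_id)
  fun_prop

theorem Admissible.exists_isGroundState (hD : D.Admissible) : ∃ v, D.IsGroundState v := by
  obtain ⟨i⟩ := hD.lap.connected.nonempty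
  have hne : (fun _ : ι => (1 : ℝ)) ≠ 0 := fun h => one_ne_zero (congrFun h i)
  obtain ⟨v, hv, hmin⟩ := hD.isCompact_unitSphere.exists_isMinOn
    ⟨_, hD.l2Inner_retraction hne⟩ continuous_energy.continuousOn
  exact ⟨v, l2Norm_eq_one_iff.2 hv, fun w hw => hmin (l2Norm_eq_one_iff.1 hw)⟩

/-- Only the off-diagonal products `u i * u j` change; they increase, against nonpositive
coefficients. -/
theorem Admissible.energy_abs_le (hD : D.Admissible) (u : ι → ℝ) :
    D.energy (fun i => |u i|) ≤ D.energy u := by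
  have h4 : ∀ x : ℝ, |x| ^ 4 = x ^ 4 := fun x => Even.pow_abs (by decide) x
  simp only [energy, sq_abs, h4]
  have : (fun i => |u i|) ⬝ᵥ ((-D.L) *ᵥ fun i => |u i|) ≤ u ⬝ᵥ ((-D.L) *ᵥ u) := by
    simp only [mulVec, dotProduct, Finset.mul_sum]
    refine Finset.sum_le_sum fun i _ => Finset.sum_le_sum fun j _ => ?_
    by_cases hij : i = j
    · subst hij
      refine le_of_eq ?_
      linear_combination (-D.L) i i * abs_mul_abs_self (u i)
    · have h1 := hD.lap.offDiag i j hij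
      have h2 : u i * u j ≤ |u i| * |u j| := by rw [← abs_mul]; exact le_abs_self _
      nlinarith [mul_nonneg_of_nonpos_of_nonpos h1 (sub_nonpos.2 h2)]
  have := mul_le_mul_of_nonneg_right this hD.cell_pos.le
  linarith

/-! ### The adaptive inner product and the energy expansion. -/

variable [DecidableEq ι]

theorem aInner_eq (u z w : ι → ℝ) : D.aInner u z w = ((D.linOp u *ᵥ z) ⬝ᵥ w) * D.h ^ D.d :=
  l2Inner_eq _ _

theorem Admissible.linOp_posDef (hD : D.Admissible) (u : ι → ℝ) : (D.linOp u).PosDef :=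
  D.linOp_posDef hD.lap hD.V_nonneg hD.β_nonneg u

theorem Admissible.linOp_transpose (hD : D.Admissible) (u : ι → ℝ) :
    (D.linOp u)ᵀ = D.linOp u := by
  simpa using (hD.linOp_posDef u).isHermitian.eq

omit [Fintype ι] in
theorem linOp_apply_ne (u : ι → ℝ) {i j : ι} (hij : i ≠ j) : D.linOp u i j = (-D.L) i j := by
  simp [linOp, hij]

omit [Fintype ι] in
theorem Admissible.linOp_nonpos (hD : D.Admissible) (u : ι → ℝ) (i j : ι) (hij : i ≠ j) :
    D.linOp u i j ≤ 0 := by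
  rw [linOp_apply_ne u hij]; exact hD.lap.offDiag i j hij

theorem Admissible.aInner_comm (hD : D.Admissible) (u z w : ι → ℝ) :
    D.aInner u z w = D.aInner u w z := by
  rw [aInner_eq, aInner_eq, dotProduct_comm, dotProduct_mulVec, ← mulVec_transpose,
    hD.linOp_transpose]

theorem Admissible.aInner_self_pos (hD : D.Admissible) (u : ι → ℝ) {z : ι → ℝ} (hz : z ≠ 0) :
    0 < D.aInner u z z := by
  rw [aInner_eq, dotProduct_comm]
  exact mul_pos (by simpa using (hD.linOp_posDef u).dotProduct_mulVec_pos hz) hD.cell_pos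

theorem Admissible.aInner_self_nonneg (hD : D.Admissible) (u z : ι → ℝ) :
    0 ≤ D.aInner u z z := by
  rcases eq_or_ne z 0 with rfl | hz
  · simp [aInner, l2Inner]
  · exact (hD.aInner_self_pos u hz).le

theorem aInner_smul_self (u : ι → ℝ) (t : ℝ) (z : ι → ℝ) :
    D.aInner u (t • z) (t • z) = t ^ 2 * D.aInner u z z := by
  simp only [aInner_eq, mulVec_smul, smul_dotProduct, dotProduct_smul, smul_eq_mul]; ring

theorem aInner_smul_left (u : ι → ℝ) (t : ℝ) (z w : ι → ℝ) :
    D.aInner u (t • z) w = t * D.aInner u z w := by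
  simp only [aInner_eq, mulVec_smul, smul_dotProduct, smul_eq_mul]; ring

theorem aInner_sub_left (u x z w : ι → ℝ) :
    D.aInner u (x - z) w = D.aInner u x w - D.aInner u z w := by
  simp only [aInner_eq, mulVec_sub, sub_dotProduct]; ring

theorem Admissible.aInner_add_smul_self (hD : D.Admissible) (u : ι → ℝ) (t : ℝ) (x y : ι → ℝ) :
    D.aInner u (x + t • y) (x + t • y) =
      D.aInner u x x + 2 * t * D.aInner u x y + t ^ 2 * D.aInner u y y := by
  have h := hD.aInner_comm u y x
  simp only [aInner_eq, mulVec_add, mulVec_smul, add_dotProduct, dotProduct_add, smul_dotProduct,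
    dotProduct_smul, smul_eq_mul] at h ⊢
  linear_combination t * h

omit [Fintype ι] in
@[fun_prop]
theorem continuous_linOp : Continuous D.linOp := by
  unfold linOp
  exact continuous_const.add (Continuous.matrix_diagonal (by fun_prop))

@[fun_prop]
theorem continuous_aInner {X : Type*} [TopologicalSpace X] {f g k : X → ι → ℝ}
    (hk : Continuous k) (hf : Continuous f) (hg : Continuous g) :
    Continuous fun x => D.aInner (k x) (f x) (g x) := by
  unfold aInner
  exact continuous_l2Inner ((continuous_linOp.comp hk).matrix_mulVec hf) hg

/-- Dependence of the adaptive inner product on the base point. -/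
theorem aInner_sub_aInner (u v z w : ι → ℝ) :
    D.aInner u z w - D.aInner v z w =
      D.β * ∑ i, (u i ^ 2 - v i ^ 2) * (z i * w i * D.h ^ D.d) := by
  rw [aInner, aInner, ← l2Inner_sub_left, ← sub_mulVec, linOp, linOp, add_sub_add_left_eq_sub,
    diagonal_sub, l2Inner, Finset.mul_sum]
  refine Finset.sum_congr rfl fun i _ => ?_
  rw [mulVec_diagonal]
  ring

/-- The exact expansion of the energy, quadratic in the density. -/
theorem energy_sub_energy (u w : ι → ℝ) :
    D.energy w - D.energy u = D.aInner u w w - D.aInner u u u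
      + D.β / 2 * ∑ i, (w i ^ 2 - u i ^ 2) ^ 2 * D.h ^ D.d := by
  have h : ∀ x, D.aInner u x x = (x ⬝ᵥ ((-D.L) *ᵥ x)) * D.h ^ D.d
      + ∑ i, D.V i * x i ^ 2 * D.h ^ D.d + D.β * ∑ i, u i ^ 2 * x i ^ 2 * D.h ^ D.d := fun x => by
    rw [aInner_eq, linOp, add_mulVec, add_dotProduct, dotProduct_comm x, add_mul, add_assoc]
    congr 1
    rw [dotProduct, Finset.mul_sum, Finset.sum_mul, ← Finset.sum_add_distrib]
    refine Finset.sum_congr rfl fun i _ => ?_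
    rw [mulVec_diagonal]
    ring
  have e : ∑ i, (w i ^ 2 - u i ^ 2) ^ 2 * D.h ^ D.d = ∑ i, w i ^ 4 * D.h ^ D.d
      - 2 * ∑ i, u i ^ 2 * w i ^ 2 * D.h ^ D.d + ∑ i, u i ^ 4 * D.h ^ D.d := by
    rw [Finset.mul_sum, ← Finset.sum_sub_distrib, ← Finset.sum_add_distrib]
    exact Finset.sum_congr rfl fun i _ => by ring
  have e' : ∑ i, u i ^ 2 * u i ^ 2 * D.h ^ D.d = ∑ i, u i ^ 4 * D.h ^ D.d :=
    Finset.sum_congr rfl fun i _ => by ring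
  rw [h, h, e, e', energy, energy]
  ring

theorem Admissible.le_energy_sub_energy (hD : D.Admissible) (u w : ι → ℝ) :
    D.aInner u w w - D.aInner u u u ≤ D.energy w - D.energy u := by
  rw [energy_sub_energy, le_add_iff_nonneg_right]
  have := hD.β_nonneg
  have := hD.cell_pos
  exact mul_nonneg (by positivity) (Finset.sum_nonneg fun i _ => by positivity)

end GPData

/-! ### The projected gradient and energy decrease. -/

namespace GPData

variable {ι : Type*} [Fintype ι] {D : GPData ι} [DecidableEq ι]

/-- The Lagrange multiplier in the projected gradient. -/
def multiplier (D : GPData ι) (u : ι → ℝ) : ℝ :=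
  D.l2Inner u u / D.aInner u (D.green u u) (D.green u u)

theorem grad_eq (u : ι → ℝ) : D.grad u = u - D.multiplier u • D.green u u := rfl

theorem Admissible.aInner_green' (hD : D.Admissible) (u z w : ι → ℝ) :
    D.aInner u z (D.green u w) = D.l2Inner z w :=
  D.aInner_green hD.lap hD.V_nonneg hD.β_nonneg u z w

theorem Admissible.linOp_green (hD : D.Admissible) (u w : ι → ℝ) :
    D.linOp u *ᵥ D.green u w = w := by
  rw [green, mulVec_mulVec, mul_nonsing_inv _ (hD.linOp_posDef u).det_pos.ne'.isUnit, one_mulVec]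

theorem Admissible.green_self_ne_zero (hD : D.Admissible) {u : ι → ℝ} (hu : u ≠ 0) :
    D.green u u ≠ 0 := fun h => hu <| by
  rw [← hD.linOp_green u u, h, mulVec_zero]

theorem Admissible.multiplier_pos (hD : D.Admissible) {u : ι → ℝ} (hu : u ≠ 0) :
    0 < D.multiplier u :=
  div_pos (hD.l2Inner_self_pos hu) (hD.aInner_self_pos u (hD.green_self_ne_zero hu))

theorem Admissible.aInner_grad (hD : D.Admissible) (u z : ι → ℝ) :
    D.aInner u (D.grad u) z = D.aInner u u z - D.multiplier u * D.l2Inner u z := by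
  rw [grad_eq, aInner_sub_left, aInner_smul_left, hD.aInner_comm u (D.green u u),
    hD.aInner_green', l2Inner_comm]

/-- The multiplier is normalized for this, since `(G_u u, G_u u)_{a_u} = (G_u u, u)`. -/
theorem Admissible.l2Inner_grad_self (hD : D.Admissible) {u : ι → ℝ} (hu : u ≠ 0) :
    D.l2Inner (D.grad u) u = 0 := by
  have := (hD.aInner_self_pos u (hD.green_self_ne_zero hu)).ne'
  rw [grad_eq, l2Inner_sub_left, l2Inner_smul_left, multiplier]
  rw [hD.aInner_green'] at this ⊢
  rw [div_mul_cancel₀ _ this, sub_self]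

theorem Admissible.aInner_self_grad (hD : D.Admissible) {u : ι → ℝ} (hu : u ≠ 0) :
    D.aInner u u (D.grad u) = D.aInner u (D.grad u) (D.grad u) := by
  rw [hD.aInner_grad u (D.grad u), l2Inner_comm u, hD.l2Inner_grad_self hu, mul_zero, sub_zero]

theorem Admissible.aInner_grad_grad (hD : D.Admissible) {u : ι → ℝ} (hu : D.l2Inner u u = 1) :
    D.aInner u (D.grad u) (D.grad u) = D.aInner u u u - D.multiplier u := by
  rw [← hD.aInner_self_grad (ne_zero_of_l2Inner hu), hD.aInner_comm, hD.aInner_grad, hu, mul_one]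

theorem Admissible.linOp_mulVec_of_grad_eq_zero (hD : D.Admissible) {u : ι → ℝ}
    (h : D.grad u = 0) : D.linOp u *ᵥ u = D.multiplier u • u := by
  rw [grad_eq, sub_eq_zero] at h
  conv_lhs => rw [h, mulVec_smul]
  rw [← h, hD.linOp_green]

theorem Admissible.green_nonneg (hD : D.Admissible) (u : ι → ℝ) {w : ι → ℝ} (hw : ∀ i, 0 ≤ w i)
    (i : ι) : 0 ≤ D.green u w i :=
  nonneg_of_mulVec_nonneg (hD.linOp_posDef u) (hD.linOp_nonpos u)
    (by rwa [hD.linOp_green]) i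

/-- One step of the method. -/
def step (D : GPData ι) (t : ℝ) (u : ι → ℝ) : ι → ℝ := D.retraction (u - t • D.grad u)

/-- Before normalization the step is a convex combination of `u` and a positive multiple of `G_u u`,
which is nonnegative by monotonicity of `A_u`. -/
theorem Admissible.step_nonneg (hD : D.Admissible) {u : ι → ℝ} (hu : u ≠ 0)
    (h0 : ∀ i, 0 ≤ u i) {t : ℝ} (ht0 : 0 ≤ t) (ht1 : t ≤ 1) (i : ι) : 0 ≤ D.step t u i := by
  have e : (u - t • D.grad u) i = (1 - t) * u i + t * (D.multiplier u * D.green u u i) := by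
    simp only [grad_eq, Pi.sub_apply, Pi.smul_apply, smul_eq_mul]; ring
  rw [step, retraction, Pi.smul_apply, smul_eq_mul, e]
  refine mul_nonneg (inv_nonneg.2 (Real.sqrt_nonneg _)) (add_nonneg
    (mul_nonneg (by linarith) (h0 i)) (mul_nonneg ht0
      (mul_nonneg (hD.multiplier_pos hu).le (hD.green_nonneg u h0 i))))

/-- Pythagoras: the gradient is `L²`-orthogonal to `u`. -/
theorem Admissible.one_le_l2Inner_sub_smul_grad (hD : D.Admissible) {u : ι → ℝ}
    (hu : D.l2Inner u u = 1) (t : ℝ) :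
    1 ≤ D.l2Inner (u - t • D.grad u) (u - t • D.grad u) := by
  rw [sub_eq_add_neg, ← neg_smul, l2Inner_add_smul_self, l2Inner_comm u (D.grad u),
    hD.l2Inner_grad_self (ne_zero_of_l2Inner hu), hu, mul_zero, add_zero]
  have := mul_nonneg (sq_nonneg (-t)) (hD.l2Inner_self_nonneg (D.grad u))
  linarith

theorem Admissible.l2Inner_step (hD : D.Admissible) {u : ι → ℝ} (hu : D.l2Inner u u = 1) (t : ℝ) :
    D.l2Inner (D.step t u) (D.step t u) = 1 := by
  refine hD.l2Inner_retraction fun h => ?_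
  have := hD.one_le_l2Inner_sub_smul_grad hu t
  rw [h] at this
  simp only [l2Inner, Pi.zero_apply, zero_mul, Finset.sum_const_zero] at this
  linarith

theorem Admissible.energy_step_le (hD : D.Admissible) {u : ι → ℝ} (hu : D.l2Inner u u = 1)
    (t : ℝ) : D.energy (D.step t u) ≤ D.energy (u - t • D.grad u) := by
  have := hD.one_le_l2Inner_sub_smul_grad hu t
  have h1 : 1 ≤ D.l2Norm (u - t • D.grad u) := Real.one_le_sqrt.2 this
  exact energy_smul_le hD (by positivity) (inv_le_one_of_one_le₀ h1) _

theorem Admissible.aInner_zero_le (hD : D.Admissible) (u x : ι → ℝ) :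
    D.aInner 0 x x ≤ D.aInner u x x := by
  rw [← sub_nonneg, aInner_sub_aInner]
  refine mul_nonneg hD.β_nonneg (Finset.sum_nonneg fun i _ => mul_nonneg ?_
    (mul_nonneg (mul_self_nonneg _) hD.cell_pos.le))
  simpa using sq_nonneg (u i)

/-- Sufficient decrease of the energy for small step sizes. -/
theorem Admissible.exists_energy_decrease (hD : D.Admissible) :
    ∃ T : ℝ, 0 < T ∧ T ≤ 1 ∧ ∀ u, D.l2Inner u u = 1 → ∀ t, 0 ≤ t → t ≤ T →
      D.energy (D.step t u) ≤ D.energy u - t * D.aInner u (D.grad u) (D.grad u) := by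
  have hc := hD.cell_pos
  have hβ := hD.β_nonneg
  obtain ⟨K, hK, hKle⟩ := exists_le_mul_of_homogeneous (f := fun x => D.aInner 0 x x)
    (g := fun x => D.l2Inner x x) (by fun_prop) (by fun_prop)
    (fun t x => aInner_smul_self 0 t x) (fun t x => l2Inner_smul_self t x)
    (fun x hx => hD.aInner_self_pos 0 hx)
  obtain ⟨M, hM⟩ := (hD.isCompact_unitSphere.image_of_continuousOn
    (f := fun u => D.aInner u u u) (by fun_prop)).bddAbove
  -- `B` bounds `(t g_i - 2 u_i)² ≤ 8 u_i² + 2 g_i²` uniformly, using `u_i² h^d ≤ 1` and `g_i² h^d ≤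
  -- K * max M 0`.
  set B : ℝ := (8 + 2 * (K * max M 0)) / D.h ^ D.d with hB
  have hB0 : 0 ≤ B := by positivity
  -- The energy change is at most `-2ta + (ta)(tC)`, where `a` is the squared gradient norm; `t ≤ 1
  -- / C` leaves at least half of the first-order decrease.
  set C : ℝ := 1 + D.β / 2 * (B * K) with hC
  have hC1 : 1 ≤ C := le_add_of_nonneg_right (by positivity)
  refine ⟨1 / C, by positivity, (div_le_one (by positivity)).2 hC1, fun u hu t ht0 htT => ?_⟩
  have ht1 : t ≤ 1 := htT.trans ((div_le_one (by positivity)).2 hC1)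
  have htC : t * C ≤ 1 := (le_div_iff₀ (by positivity)).1 htT
  have hu0 := ne_zero_of_l2Inner hu
  refine (hD.energy_step_le hu t).trans ?_
  set g := D.grad u with hg
  set a := D.aInner u g g with ha
  have ha0 : 0 ≤ a := hD.aInner_self_nonneg u g
  have haM : a ≤ max M 0 := by
    have h1 := hD.aInner_grad_grad hu
    have h2 := hD.multiplier_pos hu0
    have h3 : D.aInner u u u ≤ M := hM ⟨u, hu, rfl⟩
    exact le_max_of_le_left (by linarith)
  have hl : D.l2Inner g g ≤ K * a :=
    (hKle g).trans (mul_le_mul_of_nonneg_left (hD.aInner_zero_le u g) hK.le)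
  have e1 : D.aInner u (u - t • g) (u - t • g) = D.aInner u u u - 2 * t * a + t ^ 2 * a := by
    rw [sub_eq_add_neg, ← neg_smul, hD.aInner_add_smul_self, hD.aInner_self_grad hu0]
    ring
  have e2 : ∑ i, ((u - t • g) i ^ 2 - u i ^ 2) ^ 2 * D.h ^ D.d ≤ t ^ 2 * B * D.l2Inner g g := by
    rw [l2Inner, Finset.mul_sum]
    refine Finset.sum_le_sum fun i _ => ?_
    have hui := hD.sq_mul_le_l2Inner u i
    have hgi := hD.sq_mul_le_l2Inner g i
    rw [hu] at hui
    have hgi' : g i ^ 2 * D.h ^ D.d ≤ K * max M 0 :=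
      hgi.trans (hl.trans (mul_le_mul_of_nonneg_left haM hK.le))
    have hb : (t * g i - 2 * u i) ^ 2 ≤ B := by
      rw [hB, le_div_iff₀ hc]
      have h1 : (t * g i - 2 * u i) ^ 2 ≤ 8 * u i ^ 2 + 2 * g i ^ 2 := by
        have : t ^ 2 * g i ^ 2 ≤ g i ^ 2 :=
          mul_le_of_le_one_left (sq_nonneg _) (pow_le_one₀ ht0 ht1)
        nlinarith [sq_nonneg (t * g i + 2 * u i)]
      have h2 := mul_le_mul_of_nonneg_right h1 hc.le
      linarith
    have e : ((u - t • g) i ^ 2 - u i ^ 2) ^ 2 * D.h ^ D.d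
        = (t ^ 2 * (g i * g i * D.h ^ D.d)) * (t * g i - 2 * u i) ^ 2 := by
      simp only [Pi.sub_apply, Pi.smul_apply, smul_eq_mul]; ring
    rw [e]
    have hn : 0 ≤ t ^ 2 * (g i * g i * D.h ^ D.d) :=
      mul_nonneg (sq_nonneg _) (mul_nonneg (mul_self_nonneg _) hc.le)
    exact (mul_le_mul_of_nonneg_left hb hn).trans_eq (by ring)
  have e3 := energy_sub_energy (D := D) u (u - t • g)
  have e4 : D.β / 2 * ∑ i, ((u - t • g) i ^ 2 - u i ^ 2) ^ 2 * D.h ^ D.d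
      ≤ D.β / 2 * (t ^ 2 * B * (K * a)) :=
    mul_le_mul_of_nonneg_left (e2.trans (mul_le_mul_of_nonneg_left hl (by positivity)))
      (by positivity)
  have e5 : t ^ 2 * a + D.β / 2 * (t ^ 2 * B * (K * a)) = (t * a) * (t * C) := by
    rw [hC]; ring
  have e6 := mul_le_mul_of_nonneg_left htC (mul_nonneg ht0 ha0)
  linarith

/-! ### Nonnegative critical points: positivity, minimality, uniqueness. -/

/-- A normalized critical point which is nonnegative. -/
structure IsNonnegCritical (D : GPData ι) (v : ι → ℝ) : Prop where
  norm : D.l2Inner v v = 1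
  nonneg : ∀ i, 0 ≤ v i
  grad_eq_zero : D.grad v = 0

variable {v : ι → ℝ}

/-- At a zero of `v`, the row of the eigenvalue equation is a vanishing sum of nonpositive terms, so
`v` vanishes at all neighbours and, by connectedness, everywhere. -/
theorem IsNonnegCritical.pos (hv : D.IsNonnegCritical v) (hD : D.Admissible) (i : ι) :
    0 < v i := by
  by_contra hi
  have hi : v i = 0 := le_antisymm (not_lt.1 hi) (hv.nonneg i)
  refine ne_zero_of_l2Inner hv.norm (funext fun j => ?_)
  refine hD.lap.forall_of_step (P := fun k => v k = 0) (fun k l hkl hL hk => ?_) hi j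
  have h := congrFun (hD.linOp_mulVec_of_grad_eq_zero hv.grad_eq_zero) k
  have hle : ∀ m ∈ Finset.univ, D.linOp v k m * v m ≤ 0 := fun m _ => by
    rcases eq_or_ne k m with rfl | hkm
    · simp [hk]
    · exact mul_nonpos_of_nonpos_of_nonneg (hD.linOp_nonpos v k m hkm) (hv.nonneg m)
  simp only [mulVec, dotProduct, Pi.smul_apply, hk, smul_zero] at h
  have h0 := (Finset.sum_eq_zero_iff_of_nonpos hle).1 h l (Finset.mem_univ l)
  refine (mul_eq_zero.1 h0).resolve_left ?_
  rw [linOp_apply_ne v hkl]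
  simpa using hL

theorem IsNonnegCritical.aInner_eq (hv : D.IsNonnegCritical v) (hD : D.Admissible) (x : ι → ℝ) :
    D.aInner v v x = D.multiplier v * D.l2Inner v x := by
  rw [aInner, hD.linOp_mulVec_of_grad_eq_zero hv.grad_eq_zero, l2Inner_smul_left]

theorem IsNonnegCritical.two_mul_gap (hv : D.IsNonnegCritical v) (hD : D.Admissible)
    (x : ι → ℝ) : 2 * (D.aInner v x x - D.multiplier v * D.l2Inner x x) =
      (∑ i, ∑ j, -D.linOp v i j * (v i * v j * (x i / v i - x j / v j) ^ 2)) * D.h ^ D.d := by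
  rw [← two_mul_quadratic_form_sub (hD.linOp_transpose v) (hv.pos hD)
    (hD.linOp_mulVec_of_grad_eq_zero hv.grad_eq_zero), GPData.aInner_eq, l2Inner_eq]
  ring

theorem IsNonnegCritical.gap_summand_nonneg (hv : D.IsNonnegCritical v) (hD : D.Admissible)
    (x : ι → ℝ) (i j : ι) :
    0 ≤ -D.linOp v i j * (v i * v j * (x i / v i - x j / v j) ^ 2) := by
  rcases eq_or_ne i j with rfl | hij
  · simp
  · have := neg_nonneg.2 (hD.linOp_nonpos v i j hij)
    have := hv.pos hD i
    have := hv.pos hD j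
    positivity

theorem IsNonnegCritical.gap_nonneg (hv : D.IsNonnegCritical v) (hD : D.Admissible)
    (x : ι → ℝ) : 0 ≤ D.aInner v x x - D.multiplier v * D.l2Inner x x := by
  have h := hv.two_mul_gap hD x
  have := mul_nonneg (Finset.sum_nonneg fun i (_ : i ∈ Finset.univ) =>
    Finset.sum_nonneg fun j (_ : j ∈ Finset.univ) => hv.gap_summand_nonneg hD x i j)
    hD.cell_pos.le
  linarith

/-- The lowest eigenvalue at a nonnegative critical point is simple. -/
theorem IsNonnegCritical.exists_eq_smul (hv : D.IsNonnegCritical v) (hD : D.Admissible)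
    {x : ι → ℝ} (hx : D.aInner v x x - D.multiplier v * D.l2Inner x x = 0) :
    ∃ t : ℝ, x = t • v := by
  have h := hv.two_mul_gap hD x
  rw [hx, mul_zero, eq_comm, mul_eq_zero, or_iff_left hD.cell_pos.ne',
    Finset.sum_eq_zero_iff_of_nonneg fun i _ =>
      Finset.sum_nonneg fun j _ => hv.gap_summand_nonneg hD x i j] at h
  obtain ⟨i⟩ := hD.lap.connected.nonempty
  refine ⟨x i / v i, funext fun j => ?_⟩
  -- Each square in the representation vanishes, so the ratio is constant across edges.
  have hj : x j / v j = x i / v i := by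
    refine hD.lap.forall_of_step (P := fun k => x k / v k = x i / v i)
      (fun k l hkl hL hk => ?_) rfl j
    have h0 := (Finset.sum_eq_zero_iff_of_nonneg fun j _ =>
      hv.gap_summand_nonneg hD x k j).1 (h k (Finset.mem_univ k)) l (Finset.mem_univ l)
    rw [linOp_apply_ne v hkl] at h0
    have h1 := (hv.pos hD k).ne'
    have h2 := (hv.pos hD l).ne'
    have h3 : x k / v k - x l / v l = 0 := by simpa [hL, h1, h2] using h0
    rw [← hk]
    linarith
  rw [Pi.smul_apply, smul_eq_mul, ← hj, div_mul_cancel₀ _ (hv.pos hD j).ne']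

theorem IsNonnegCritical.gap_le_energy (hv : D.IsNonnegCritical v) (hD : D.Admissible)
    {w : ι → ℝ} (hw : D.l2Inner w w = 1) :
    D.aInner v w w - D.multiplier v * D.l2Inner w w ≤ D.energy w - D.energy v := by
  have := hD.le_energy_sub_energy v w
  rwa [hv.aInner_eq hD, hv.norm, ← hw] at this

theorem IsNonnegCritical.isGroundState (hv : D.IsNonnegCritical v) (hD : D.Admissible) :
    D.IsGroundState v := by
  refine ⟨l2Norm_eq_one_iff.2 hv.norm, fun w hw => ?_⟩
  have h1 := hv.gap_le_energy hD (l2Norm_eq_one_iff.1 hw)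
  have h2 := hv.gap_nonneg hD w
  linarith

theorem IsNonnegCritical.eq_or_eq_neg (hv : D.IsNonnegCritical v) (hD : D.Admissible)
    {w : ι → ℝ} (hw : D.IsGroundState w) : w = v ∨ w = -v := by
  have hw1 := l2Norm_eq_one_iff.1 hw.1
  have h1 := hv.gap_le_energy hD hw1
  have h2 := hv.gap_nonneg hD w
  have h3 := hw.2 v (l2Norm_eq_one_iff.2 hv.norm)
  obtain ⟨t, rfl⟩ := hv.exists_eq_smul hD (x := w) (by linarith)
  rw [l2Inner_smul_self, hv.norm, mul_one, sq_eq_one_iff] at hw1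
  rcases hw1 with rfl | rfl <;> simp

theorem IsNonnegCritical.unique (hv : D.IsNonnegCritical v) (hD : D.Admissible)
    {w : ι → ℝ} (hw : D.IsNonnegCritical w) : w = v := by
  rcases hv.eq_or_eq_neg hD (hw.isGroundState hD) with h | h
  · exact h
  · obtain ⟨i⟩ := hD.lap.connected.nonempty
    have h1 := hw.pos hD i
    have h2 := hv.pos hD i
    rw [h, Pi.neg_apply] at h1
    linarith

/-- If the gradient at `|w|` were nonzero, one descent step would go strictly below the minimal
energy. -/
theorem Admissible.exists_isNonnegCritical (hD : D.Admissible) : ∃ v, D.IsNonnegCritical v := by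
  obtain ⟨w, hw1, hw⟩ := hD.exists_isGroundState
  obtain ⟨T, hT, -, hdec⟩ := hD.exists_energy_decrease
  have hn : D.l2Inner (fun i => |w i|) (fun i => |w i|) = 1 := by
    rw [← l2Norm_eq_one_iff.1 hw1]
    simp only [l2Inner, abs_mul_abs_self]
  refine ⟨fun i => |w i|, hn, fun i => abs_nonneg _, ?_⟩
  have h1 := hdec _ hn T hT.le le_rfl
  have h2 := hw _ (l2Norm_eq_one_iff.2 (hD.l2Inner_step hn T))
  have h3 := hD.energy_abs_le w
  by_contra hne
  have := mul_pos hT (hD.aInner_self_pos (fun i => |w i|) hne)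
  linarith

end GPData

/-! ### Spectral gap and local energy inequalities. -/

namespace GPData

variable {ι : Type*} [Fintype ι] {D : GPData ι} [DecidableEq ι] {v : ι → ℝ}

theorem Admissible.continuous_green (hD : D.Admissible) : Continuous fun u => D.green u u := by
  have h : Continuous fun u => (D.linOp u)⁻¹ := by
    simp only [Matrix.inv_def, Ring.inverse_eq_inv]
    exact (continuous_linOp.matrix_det.inv₀ fun u => (hD.linOp_posDef u).det_pos.ne').smul
      continuous_linOp.matrix_adjugate
  exact h.matrix_mulVec continuous_id

theorem Admissible.continuousAt_grad (hD : D.Admissible) {u : ι → ℝ} (hu : u ≠ 0) :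
    ContinuousAt D.grad u := by
  have hg := hD.continuous_green
  have h1 : Continuous fun u => D.l2Inner u u := by fun_prop
  have h2 : Continuous fun u => D.aInner u (D.green u u) (D.green u u) := by fun_prop
  exact continuousAt_id.sub ((h1.continuousAt.div h2.continuousAt
    (hD.aInner_self_pos u (hD.green_self_ne_zero hu)).ne').smul hg.continuousAt)

/-- The spectral gap at a nonnegative critical point. -/
theorem IsNonnegCritical.exists_gap (hv : D.IsNonnegCritical v) (hD : D.Admissible) :
    ∃ K : ℝ, 0 < K ∧ ∀ x, D.l2Inner x x ≤
      K * (D.aInner v x x - D.multiplier v * D.l2Inner x x + D.l2Inner x v ^ 2) := by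
  -- The gap form degenerates exactly along `v`; the term `(x,v)²` restores definiteness.
  refine exists_le_mul_of_homogeneous (g := fun x => D.l2Inner x x)
    (f := fun x => D.aInner v x x - D.multiplier v * D.l2Inner x x + D.l2Inner x v ^ 2)
    (by fun_prop) (by fun_prop) (fun t x => ?_) (fun t x => l2Inner_smul_self t x)
    (fun x hx => ?_)
  · rw [aInner_smul_self, l2Inner_smul_self, l2Inner_smul_left]
    ring
  · rcases (hv.gap_nonneg hD x).lt_or_eq with h | h
    · exact add_pos_of_pos_of_nonneg h (sq_nonneg _)
    · obtain ⟨t, rfl⟩ := hv.exists_eq_smul hD h.symm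
      have ht : t ≠ 0 := by
        rintro rfl
        simp at hx
      rw [← h, zero_add, l2Inner_smul_left, hv.norm, mul_one]
      positivity

theorem Admissible.exists_aInner_le (hD : D.Admissible) (u : ι → ℝ) :
    ∃ K : ℝ, 0 < K ∧ ∀ x, D.aInner u x x ≤ K * D.l2Inner x x :=
  exists_le_mul_of_homogeneous (f := fun x => D.l2Inner x x) (g := fun x => D.aInner u x x)
    (by fun_prop) (by fun_prop) (fun t x => l2Inner_smul_self t x)
    (fun t x => aInner_smul_self u t x) (fun _ hx => hD.l2Inner_self_pos hx)

theorem Admissible.abs_aInner_sub_le (hD : D.Admissible) {u v : ι → ℝ} {r : ℝ}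
    (h : ∀ i, |D.β * (u i ^ 2 - v i ^ 2)| ≤ r) (x : ι → ℝ) :
    |D.aInner u x x - D.aInner v x x| ≤ r * D.l2Inner x x := by
  rw [aInner_sub_aInner, Finset.mul_sum, l2Inner, Finset.mul_sum]
  refine (Finset.abs_sum_le_sum_abs _ _).trans (Finset.sum_le_sum fun i _ => ?_)
  have h0 : 0 ≤ x i * x i * D.h ^ D.d := mul_nonneg (mul_self_nonneg _) hD.cell_pos.le
  rw [← mul_assoc, abs_mul, abs_of_nonneg h0]
  exact mul_le_mul_of_nonneg_right (h i) h0

/-- Near a nonnegative critical point the energy grows quadratically, and it satisfies a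
Polyak–Łojasiewicz inequality. -/
theorem IsNonnegCritical.eventually_energy_bounds (hv : D.IsNonnegCritical v)
    (hD : D.Admissible) : ∃ K : ℝ, 0 < K ∧ ∀ᶠ u in 𝓝 v, D.l2Inner u u = 1 →
      D.energy u - D.energy v ≤ K * D.aInner u (D.grad u) (D.grad u) ∧
      D.l2Inner (u - v) (u - v) ≤ K * (D.energy u - D.energy v) := by
  obtain ⟨K₁, hK₁, hgap⟩ := hv.exists_gap hD
  obtain ⟨K₂, hK₂, hle⟩ := hD.exists_aInner_le v
  set l := D.multiplier v with hl
  set r : ℝ := 1 / (8 * K₁) with hr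
  have hr0 : 0 < r := by positivity
  have hrK : r * K₁ = 1 / 8 := by rw [hr]; field_simp
  set s : ℝ := 2 * K₁ * (K₂ + r) with hs
  have hs0 : 0 < s := by positivity
  have ev1 : ∀ᶠ u in 𝓝 v, ∀ i, |D.β * (u i ^ 2 - v i ^ 2)| < r := by
    rw [eventually_all]
    intro i
    have : Continuous fun u : ι → ℝ => |D.β * (u i ^ 2 - v i ^ 2)| := by fun_prop
    exact this.continuousAt.eventually_lt continuousAt_const (by simpa using hr0)
  have ev2 : ∀ᶠ u in 𝓝 v, D.l2Inner (v - u) (v - u) < 8 * r := by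
    have : Continuous fun u : ι → ℝ => D.l2Inner (v - u) (v - u) := by fun_prop
    exact this.continuousAt.eventually_lt continuousAt_const (by simpa [l2Inner] using hr0)
  have ev3 : ∀ᶠ u in 𝓝 v, D.aInner u u u < l + r := by
    have : Continuous fun u : ι → ℝ => D.aInner u u u := by fun_prop
    refine this.continuousAt.eventually_lt continuousAt_const ?_
    rw [hv.aInner_eq hD, hv.norm]
    linarith
  refine ⟨s + 2 * K₁, by positivity, ?_⟩
  filter_upwards [ev1, ev2, ev3] with u h1 h2 h3 hu
  set e := v - u with he
  set m := D.l2Inner e e with hm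
  have hm0 : 0 ≤ m := hD.l2Inner_self_nonneg e
  have hm' : m = 2 - 2 * D.l2Inner u v := by
    have : e = v + (-1 : ℝ) • u := by rw [he, neg_one_smul, sub_eq_add_neg]
    rw [hm, this, l2Inner_add_smul_self, hv.norm, hu, l2Inner_comm v u]
    ring
  have hev : D.l2Inner e v = m / 2 := by
    rw [he, l2Inner_sub_left, hv.norm]
    linarith
  have hue : D.l2Inner u e = -(m / 2) := by
    rw [l2Inner_comm, he, l2Inner_sub_left, hu, l2Inner_comm v u]
    linarith
  -- On the sphere `(e,v) = m/2`, so the penalty is quadratic in `m` and, for `m < 8r`, is absorbed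
  -- at the cost of `m/4`.
  have hg : 3 / 4 * m ≤ K₁ * (D.aInner v e e - l * m) := by
    have := hgap e
    rw [hev] at this
    have h4 : m * m ≤ 8 * r * m := mul_le_mul_of_nonneg_right h2.le hm0
    have h5 := mul_le_mul_of_nonneg_left h4 hK₁.le
    have h6 : K₁ * (8 * r * m) = m := by linear_combination 8 * m * hrK
    nlinarith
  -- The gap form has `v` in its kernel, so it takes the same value at `u = v - e` and at `e`.
  have hEv : D.aInner v e e - l * m ≤ D.energy u - D.energy v := by
    have h4 := hv.gap_le_energy hD hu
    have h5 : u = v + (-1 : ℝ) • e := by rw [he]; simp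
    have h6 : D.aInner v u u = D.aInner v e e - l * m + l := by
      rw [h5, hD.aInner_add_smul_self, hv.aInner_eq hD, hv.aInner_eq hD, hv.norm,
        l2Inner_comm v e, hev]
      ring
    rw [h6, hu] at h4
    linarith
  have hEv0 : 0 ≤ D.energy u - D.energy v := (hv.gap_nonneg hD e).trans hEv
  have hd0 := hD.aInner_self_nonneg u (D.grad u)
  have habs := abs_le.1 (hD.abs_aInner_sub_le (fun i => (h1 i).le) e)
  have hPL : D.energy u - D.energy v ≤ s * D.aInner u (D.grad u) (D.grad u) := by
    have h4 := hD.le_energy_sub_energy u v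
    have h5 : v = u + (1 : ℝ) • e := by rw [he]; simp
    have h6 : D.aInner u v v = D.aInner u u u + 2 * D.aInner u u e + D.aInner u e e := by
      conv_lhs => rw [h5, hD.aInner_add_smul_self]
      ring
    have h7 := hD.aInner_grad u e
    rw [hue] at h7
    have h8 := hD.aInner_grad_grad hu
    have h9 : D.multiplier u * m ≤ (l + r) * m :=
      mul_le_mul_of_nonneg_right (by linarith) hm0
    -- Young's inequality in the form `0 ≤ ‖e + s g‖²`; the weight `s = 2 K₁ (K₂ + r)` makes the
    -- common factor `K₂ + r` cancel.
    have h10 := hD.aInner_self_nonneg u (e + s • D.grad u)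
    rw [hD.aInner_add_smul_self, hD.aInner_comm u e (D.grad u)] at h10
    have h11 : D.aInner u e e ≤ (K₂ + r) * m := by
      have := hle e
      linarith
    have h12 : 0 ≤ (K₂ + r) * (m + 4 * K₁ * D.aInner u (D.grad u) e
        + 2 * K₁ * s * D.aInner u (D.grad u) (D.grad u)) := by
      have e1 : s ^ 2 = (K₂ + r) * (2 * K₁ * s) := by rw [hs]; ring
      have e2 : 2 * s = (K₂ + r) * (4 * K₁) := by rw [hs]; ring
      rw [e1, e2] at h10
      linarith
    have h13 := nonneg_of_mul_nonneg_right h12 (by positivity)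
    have h14 : K₁ * (D.energy u - D.energy v)
        ≤ K₁ * (s * D.aInner u (D.grad u) (D.grad u)) := by
      -- After multiplication by `K₁`, the error `2rm` costs `m/4` and the gap gains `3m/4`; the net
      -- `-m/2` pays for the cross term through `h13`.
      have h15 : D.energy u - D.energy v ≤ -2 * D.aInner u (D.grad u) e + 2 * (r * m)
          - (D.aInner v e e - l * m) := by linarith
      have h16 := mul_le_mul_of_nonneg_left h15 hK₁.le
      have h17 : K₁ * (r * m) = m / 8 := by linear_combination m * hrK
      linarith
    exact le_of_mul_le_mul_left h14 hK₁
  have hsym : D.l2Inner (u - v) (u - v) = m := by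
    have : u - v = (-1 : ℝ) • e := by rw [he]; simp
    rw [this, l2Inner_smul_self]
    ring
  constructor
  · have := mul_nonneg hK₁.le hd0
    linarith
  · rw [hsym]
    have h4 := mul_le_mul_of_nonneg_left hEv hK₁.le
    have h5 := mul_nonneg hs0.le hEv0
    have h6 := mul_nonneg hK₁.le hEv0
    linarith

/-! ### Global convergence and the asymptotic rate. -/

section Iteration

variable {T δ : ℝ} {u₀ : ι → ℝ} {τ : ℕ → ℝ}

theorem sobolevPGD_succ (τ : ℕ → ℝ) (u₀ : ι → ℝ) (n : ℕ) :
    D.sobolevPGD τ u₀ (n + 1) = D.step (τ n) (D.sobolevPGD τ u₀ n) := rfl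

theorem Admissible.sobolevPGD_mem (hD : D.Admissible) (hu : D.l2Inner u₀ u₀ = 1)
    (h0 : ∀ i, 0 ≤ u₀ i) (hτ : ∀ n, 0 ≤ τ n ∧ τ n ≤ 1) (n : ℕ) :
    D.l2Inner (D.sobolevPGD τ u₀ n) (D.sobolevPGD τ u₀ n) = 1 ∧
      ∀ i, 0 ≤ D.sobolevPGD τ u₀ n i := by
  induction n with
  | zero => exact ⟨hu, h0⟩
  | succ n ih =>
    rw [sobolevPGD_succ]
    exact ⟨hD.l2Inner_step ih.1 _,
      hD.step_nonneg (ne_zero_of_l2Inner ih.1) ih.2 (hτ n).1 (hτ n).2⟩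

/-- A sequence in the nonnegative part of the sphere along which the gradient tends to zero
converges to the nonnegative critical point. -/
theorem IsNonnegCritical.tendsto_of_grad (hv : D.IsNonnegCritical v) (hD : D.Admissible)
    {u : ℕ → ι → ℝ} (hu : ∀ n, D.l2Inner (u n) (u n) = 1 ∧ ∀ i, 0 ≤ u n i)
    (hg : Tendsto (fun n => D.aInner (u n) (D.grad (u n)) (D.grad (u n))) atTop (𝓝 0)) :
    Tendsto u atTop (𝓝 v) := by
  have hcl : IsClosed {w : ι → ℝ | ∀ i, 0 ≤ w i} := by
    have : {w : ι → ℝ | ∀ i, 0 ≤ w i} = Set.Ici 0 := Set.ext fun _ => Iff.rfl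
    rw [this]
    exact isClosed_Ici
  refine (hD.isCompact_unitSphere.inter_right hcl).tendsto_nhds_of_unique_mapClusterPt
    (Eventually.of_forall fun n => hu n) fun w hw hcp => ?_
  obtain ⟨ψ, hψ, hlim⟩ := hcp.tendsto_subseq
  have hw0 : w ≠ 0 := ne_zero_of_l2Inner hw.1
  have hgr := (hD.continuousAt_grad hw0).tendsto.comp hlim
  have hc : Continuous fun p : (ι → ℝ) × (ι → ℝ) => D.aInner p.1 p.2 p.2 := by fun_prop
  have h1 := (hc.tendsto (w, D.grad w)).comp (hlim.prodMk_nhds hgr)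
  have h2 := tendsto_nhds_unique h1 (hg.comp hψ.tendsto_atTop)
  refine hv.unique hD ⟨hw.1, hw.2, ?_⟩
  by_contra hne
  exact (hD.aInner_self_pos w hne).ne' h2

/-- Energies decrease and are bounded below, hence converge; their consecutive differences divided
by `δ` dominate the squared gradient norms. -/
theorem IsNonnegCritical.tendsto_sobolevPGD (hv : D.IsNonnegCritical v) (hD : D.Admissible)
    (hT1 : T ≤ 1)
    (hdec : ∀ u, D.l2Inner u u = 1 → ∀ t, 0 ≤ t → t ≤ T →
      D.energy (D.step t u) ≤ D.energy u - t * D.aInner u (D.grad u) (D.grad u))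
    (hδ : 0 < δ) (hu : D.l2Inner u₀ u₀ = 1) (h0 : ∀ i, 0 ≤ u₀ i)
    (hτ : ∀ n, δ ≤ τ n ∧ τ n ≤ T) : Tendsto (D.sobolevPGD τ u₀) atTop (𝓝 v) := by
  set u := D.sobolevPGD τ u₀ with hudef
  have hmem := hD.sobolevPGD_mem hu h0
    fun n => ⟨hδ.le.trans (hτ n).1, (hτ n).2.trans hT1⟩
  have hstep : ∀ n, D.energy (u (n + 1))
      ≤ D.energy (u n) - δ * D.aInner (u n) (D.grad (u n)) (D.grad (u n)) := fun n => by
    have h1 := hdec _ (hmem n).1 (τ n) (hδ.le.trans (hτ n).1) (hτ n).2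
    have h2 := mul_le_mul_of_nonneg_right (hτ n).1
      (hD.aInner_self_nonneg (u n) (D.grad (u n)))
    rw [hudef, sobolevPGD_succ]
    linarith
  refine hv.tendsto_of_grad hD hmem ?_
  have hanti : Antitone fun n => D.energy (u n) := antitone_nat_of_succ_le fun n => by
    have := mul_nonneg hδ.le (hD.aInner_self_nonneg (u n) (D.grad (u n)))
    linarith [hstep n]
  have hbdd : BddBelow (Set.range fun n => D.energy (u n)) := by
    refine ⟨D.energy v, ?_⟩
    rintro _ ⟨n, rfl⟩
    exact (hv.isGroundState hD).2 _ (l2Norm_eq_one_iff.2 (hmem n).1)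
  have hlim := tendsto_atTop_ciInf hanti hbdd
  have hdiff := (hlim.sub (hlim.comp (tendsto_add_atTop_nat 1))).div_const δ
  rw [sub_self, zero_div] at hdiff
  refine squeeze_zero (fun n => hD.aInner_self_nonneg _ _) (fun n => ?_) hdiff
  rw [le_div_iff₀ hδ]
  have := hstep n
  simp only [Function.comp_apply]
  linarith

theorem IsNonnegCritical.exists_rate (hv : D.IsNonnegCritical v) (hD : D.Admissible)
    (hT1 : T ≤ 1)
    (hdec : ∀ u, D.l2Inner u u = 1 → ∀ t, 0 ≤ t → t ≤ T →
      D.energy (D.step t u) ≤ D.energy u - t * D.aInner u (D.grad u) (D.grad u))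
    (hδ : 0 < δ) (hδT : δ ≤ T) :
    ∃ q : ℝ, 0 < q ∧ q < 1 ∧ ∀ (u₀ : ι → ℝ) (τ : ℕ → ℝ), D.l2Inner u₀ u₀ = 1 →
      (∀ i, 0 ≤ u₀ i) → (∀ n, δ ≤ τ n ∧ τ n ≤ T) →
        Tendsto (D.sobolevPGD τ u₀) atTop (𝓝 v) ∧
        ∃ (C : ℝ) (n₀ : ℕ), ∀ n, n₀ ≤ n → D.aNorm 0 (D.sobolevPGD τ u₀ n - v) ≤ C * q ^ n := by
  obtain ⟨K, hK, hloc⟩ := hv.eventually_energy_bounds hD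
  obtain ⟨M, hM, hMle⟩ := hD.exists_aInner_le 0
  -- `K` is fixed before the sequence, so `θ` does not depend on it; `K + 1` ensures `θ > 0` since
  -- `δ ≤ 1`. The rate is `√θ` because the energy excess controls the squared distance.
  set θ : ℝ := 1 - δ / (K + 1) with hθ
  have hθ0 : 0 < θ := by
    rw [hθ, sub_pos, div_lt_one (by positivity)]
    linarith
  have hθ1 : θ < 1 := by
    have : 0 < δ / (K + 1) := by positivity
    linarith
  refine ⟨√θ, Real.sqrt_pos.2 hθ0, by rwa [Real.sqrt_lt' one_pos, one_pow], ?_⟩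
  intro u₀ τ hu h0 hτ
  have hlim := hv.tendsto_sobolevPGD hD hT1 hdec hδ hu h0 hτ
  refine ⟨hlim, ?_⟩
  have hmem := hD.sobolevPGD_mem hu h0
    fun n => ⟨hδ.le.trans (hτ n).1, (hτ n).2.trans hT1⟩
  set u := D.sobolevPGD τ u₀ with hudef
  obtain ⟨n₀, hn₀⟩ := eventually_atTop.1 (hlim.eventually hloc)
  set E : ℕ → ℝ := fun n => D.energy (u n) - D.energy v with hE
  have hcontr : ∀ n, n₀ ≤ n → E (n + 1) ≤ θ * E n := fun n hn => by
    have h1 := hdec _ (hmem n).1 (τ n) (hδ.le.trans (hτ n).1) (hτ n).2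
    have ha := hD.aInner_self_nonneg (u n) (D.grad (u n))
    have h2 := mul_le_mul_of_nonneg_right (hτ n).1 ha
    have h3 : E n / (K + 1) ≤ D.aInner (u n) (D.grad (u n)) (D.grad (u n)) := by
      rw [div_le_iff₀ (by positivity)]
      have := (hn₀ n hn (hmem n).1).1
      simp only [hE]
      linarith
    have h4 := mul_le_mul_of_nonneg_left h3 hδ.le
    have h5 : θ * E n = E n - δ * (E n / (K + 1)) := by rw [hθ]; ring
    have h6 : E (n + 1) = D.energy (D.step (τ n) (u n)) - D.energy v := rfl
    rw [h5, h6]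
    simp only [hE] at h4 ⊢
    linarith
  have hgeo : ∀ n, n₀ ≤ n → E n ≤ E n₀ / θ ^ n₀ * θ ^ n := fun n hn => by
    induction n, hn using Nat.le_induction with
    | base => rw [div_mul_cancel₀ _ (by positivity)]
    | succ n hn ih =>
      refine (hcontr n hn).trans ((mul_le_mul_of_nonneg_left ih hθ0.le).trans_eq ?_)
      ring
  have hE0 : 0 ≤ E n₀ := sub_nonneg.2 ((hv.isGroundState hD).2 _
    (l2Norm_eq_one_iff.2 (hmem n₀).1))
  refine ⟨√(M * (K * (E n₀ / θ ^ n₀))), n₀, fun n hn => ?_⟩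
  have h1 := (hn₀ n hn (hmem n).1).2
  have h2 : D.aInner 0 (u n - v) (u n - v) ≤ M * (K * (E n₀ / θ ^ n₀)) * θ ^ n := by
    refine (hMle _).trans ?_
    rw [mul_assoc, mul_assoc]
    exact mul_le_mul_of_nonneg_left
      (h1.trans (mul_le_mul_of_nonneg_left (hgeo n hn) hK.le)) hM.le
  rw [aNorm]
  refine (Real.sqrt_le_sqrt h2).trans_eq ?_
  rw [Real.sqrt_mul (by positivity)]
  congr 1
  rw [Real.sqrt_eq_iff_mul_self_eq (by positivity) (by positivity), ← mul_pow,
    Real.mul_self_sqrt hθ0.le]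

end Iteration

end GPData

end DiscreteGP

end

theorem mainTheorem9 {ι : Type*} [Fintype ι] [DecidableEq ι] (D : DiscreteGP.GPData ι)
    (hh : 0 < D.h) (hL : DiscreteGP.IsDiscreteLaplacian D.L) (hV : ∀ i, 0 ≤ D.V i)
    (hβ : 0 ≤ D.β) :
    ∃ v : ι → ℝ, D.IsGroundState v ∧ (∀ i, 0 < v i) ∧
      (∀ w : ι → ℝ, D.IsGroundState w → w = v ∨ w = -v) ∧
      ∃ τmax : ℝ, 0 < τmax ∧ τmax ≤ 1 ∧
        ∀ τmin : ℝ, 0 < τmin → τmin ≤ τmax →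
          ∃ q : ℝ, 0 < q ∧ q < 1 ∧
            ∀ (u₀ : ι → ℝ) (τ : ℕ → ℝ), D.l2Norm u₀ = 1 → (∀ i, 0 ≤ u₀ i) →
              (∀ n, τmin ≤ τ n ∧ τ n ≤ τmax) →
                Tendsto (D.sobolevPGD τ u₀) atTop (𝓝 v) ∧
                ∃ (C : ℝ) (n₀ : ℕ), ∀ n, n₀ ≤ n →
                  D.aNorm 0 (D.sobolevPGD τ u₀ n - v) ≤ C * q ^ n := by
  have hD : D.Admissible := ⟨hh, hL, hV, hβ⟩
  obtain ⟨v, hv⟩ := hD.exists_isNonnegCritical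
  obtain ⟨T, hT, hT1, hdec⟩ := hD.exists_energy_decrease
  refine ⟨v, hv.isGroundState hD, hv.pos hD, fun w hw => hv.eq_or_eq_neg hD hw, T, hT, hT1,
    fun δ hδ hδT => ?_⟩
  obtain ⟨q, hq0, hq1, hq⟩ := hv.exists_rate hD hT1 hdec hδ hδT
  exact ⟨q, hq0, hq1, fun u₀ τ hu h0 hτ =>
    hq u₀ τ (DiscreteGP.GPData.l2Norm_eq_one_iff.1 hu) h0 hτ⟩
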